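/- Let $S$ be a commutative semiring and $M$ an $S$-semimodule. The natural preorder on $M$ is: $x\leqslant y$ if and only if $y=x+z$ for some $z\in M$. Suppose that $M$ is naturally complete (every subset of $M$ has a unique infimum and a unique supremum for $\leqslant$) and naturally inf-semilattice ordered ($(x\wedge y)+z=(x+z)\wedge(y+z)$ for all $x,y,z\in M$, the meets being taken for $\leqslant$). Let $X$ be a finite digraph with vertex set $V_X$ and edge set $E_X$ (every edge $c$ has a source $\partial_-c$ and a target $\partial_+c$; loops and parallel edges are allowed), weighted by elements $\omega_c\in M$ $(c\in E_X)$. Let $e\in E_X$ be an edge such that $X-e$ is acyclic, that is, contains no directed loop. A flow is a function $\phi:E_X\to M$ such that $\phi(c)\leqslant\omega_c$ for every edge $c$ and $\sum_{\partial_-c=v}\phi(c)=\sum_{\partial_+c=v}\phi(c)$ for every vertex $v$. A cellular $S$-sheaf $\mathcal F$ on $X$ assigns an $S$-semimodule to every vertex and every edge, and an $S$-homomorphism $\mathcal F(v)\to\mathcal F(c)$ to every endpoint $v$ of every edge $c$; it is flat if tensoring with each $\mathcal F(v)$ and each $\mathcal F(c)$ preserves equalizers of $S$-semimodules. An $\mathcal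 F$-flow consists, for every edge $c$, of an element of $\mathcal F(v)$ for each endpoint $v$ of $c$, these elements having the same image in $\mathcal F(c)$, such that at every vertex $v$ the sum in $\mathcal F(v)$ over the edges with source $v$ equals the sum over the edges with target $v$. A flow $\phi$ is $S$-decomposable if it is the image of an $\mathcal F$-flow under a natural transformation from some flat cellular $S$-sheaf $\mathcal F$ on $X$ to the constant sheaf at $M$. An $e$-cut is either the set $\{e\}$ or a set of the form $\{c\in E_X:\partial_-c\in A,\ \partial_+c\notin A\}$ where $A\subset V_X$, $\partial_+e\in A$ and $\partial_-e\notin A$. Then $$\bigvee_{\phi\ S\text{-decomposable flow}}\phi(e)\;=\;\bigwedge_{C\ e\text{-cut}}\ \sum_{c\in C}\omega_c .$$ If moreover $\omega_e$ is the greatest element of $M$ (so that $e$ is unconstrained), then the meet on the right may be taken over the $e$-cuts of the second form only. -/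

import Mathlib

open scoped TensorProduct BigOperators

namespace AlgMFMC

universe u v w

/-! ### The natural preorder of a semimodule -/

section Order

variable {M : Type v} [AddCommMonoid M]

/-- The natural preorder: `x ≤ y` iff `y = x + z` for some `z`; its upper sets are the additive
ideals.  (Over a nontrivial semiring `S` the elements `l • z`, with `l ≠ 0` in `S` and `z` in `M`,
exhaust `M`, so that the relations `x ≤ l • z + x` define the same preorder.) -/
def NatLE (x y : M) : Prop := ∃ z : M, y = x + z

/-- `m` is a greatest lower bound of `s` for the natural preorder. -/
def IsNatGLB (s : Set M) (m : M) : Prop :=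
  (∀ x ∈ s, NatLE m x) ∧ ∀ b : M, (∀ x ∈ s, NatLE b x) → NatLE b m

/-- `m` is a least upper bound of `s` for the natural preorder. -/
def IsNatLUB (s : Set M) (m : M) : Prop :=
  (∀ x ∈ s, NatLE x m) ∧ ∀ b : M, (∀ x ∈ s, NatLE x b) → NatLE m b

variable (M) in
/-- Every subset has a unique infimum and a unique supremum for the natural preorder. -/
def NaturallyComplete : Prop :=
  ∀ s : Set M, (∃! m, IsNatGLB s m) ∧ (∃! m, IsNatLUB s m)

variable (M) in
/-- Every pair has a unique greatest lower bound `x ⊓ y` for the natural preorder, and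
`(x ⊓ y) + z = (x + z) ⊓ (y + z)`. -/
def NaturallyInfSemilatticeOrdered : Prop :=
  (∀ x y : M, ∃! m, IsNatGLB {x, y} m) ∧
  ∀ x y z m : M, IsNatGLB {x, y} m → IsNatGLB {x + z, y + z} (m + z)

end Order

/-! ### Digraphs -/

/-- A digraph all of whose edges have a source and a target; loops and parallel edges are allowed.
Together with finiteness of `V` and `E` this is a compact digraph. -/
structure DiGraph (V : Type*) (E : Type*) where
  src : E → V
  tgt : E → V

namespace DiGraph

variable {V E : Type*} (X : DiGraph V E)

/-- The vertex `v` is a face of the edge `c`. -/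
def Incident (v : V) (c : E) : Prop := v = X.src c ∨ v = X.tgt c

/-- The vertices `W` and the edges `L` form a directed loop: a nonempty subdigraph, containing the
endpoints of its edges, in which every vertex has in-degree `1` and out-degree `1`. -/
def IsDirectedLoop (W : Set V) (L : Set E) : Prop :=
  W.Nonempty ∧ (∀ c ∈ L, X.src c ∈ W ∧ X.tgt c ∈ W) ∧
  ∀ v ∈ W, (∃! c, c ∈ L ∧ X.src c = v) ∧ (∃! c, c ∈ L ∧ X.tgt c = v)

/-- The digraph `X - e` contains no directed loop. -/
def AcyclicWithout (e : E) : Prop :=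
  ∀ (W : Set V) (L : Set E), X.IsDirectedLoop W L → e ∈ L

/-- `C` is the set `A : V - A` of the edges from `A` to `V - A`, for a vertex set `A` that
contains `s` and does not contain `t`. -/
def IsCut (s t : V) (C : Finset E) : Prop :=
  ∃ A : Set V, s ∈ A ∧ t ∉ A ∧ ∀ c : E, c ∈ C ↔ X.src c ∈ A ∧ X.tgt c ∉ A

/-- The cuts that separate the target of `e` from the source of `e`. -/
def IsProperEdgeCut (e : E) (C : Finset E) : Prop := X.IsCut (X.tgt e) (X.src e) C

/-- An `e`-cut: either the edge `e` alone, or a cut that separates the target of `e` from its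
source. -/
def IsEdgeCut (e : E) (C : Finset E) : Prop := C = {e} ∨ X.IsProperEdgeCut e C

end DiGraph

/-! ### Flows -/

/-- A flow on the weighted digraph `(X; ω)`: capacities are respected and, at every vertex, the
outgoing and the incoming values have the same sum. -/
def IsFlow {V E : Type*} [Fintype E] {M : Type v} [AddCommMonoid M]
    (X : DiGraph V E) (ω : E → M) (φ : E → M) : Prop :=
  open scoped Classical in
  (∀ c, NatLE (φ c) (ω c)) ∧
  ∀ v : V, (∑ c : {c : E // X.src c = v}, φ c.1) = ∑ c : {c : E // X.tgt c = v}, φ c.1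

/-! ### Flat semimodules and sheaves -/

/-- `F` is flat: tensoring with `F` preserves equalizers of `S`-semimodules. -/
def FlatSemimodule (S : Type u) [CommSemiring S] (F : Type (max u w)) [AddCommMonoid F]
    [Module S F] : Prop :=
  ∀ (A B : Type (max u w)) [AddCommMonoid A] [AddCommMonoid B] [Module S A] [Module S B]
    (f g : A →ₗ[S] B),
    Function.Injective (LinearMap.lTensor F (LinearMap.eqLocus f g).subtype) ∧
    ∀ t : F ⊗[S] A, LinearMap.lTensor F f t = LinearMap.lTensor F g t →
      t ∈ LinearMap.range (LinearMap.lTensor F (LinearMap.eqLocus f g).subtype)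

/-- A cellular `S`-sheaf on `X`: an `S`-semimodule for every vertex and every edge, and a
restriction map from a vertex to an edge for every incidence. -/
structure CellSheaf (S : Type u) [CommSemiring S] {V E : Type*} (X : DiGraph V E) where
  onV : V → Type (max u w)
  onE : E → Type (max u w)
  [acmV : ∀ v, AddCommMonoid (onV v)]
  [acmE : ∀ c, AddCommMonoid (onE c)]
  [modV : ∀ v, Module S (onV v)]
  [modE : ∀ c, Module S (onE c)]
  res : ∀ (v : V) (c : E), X.Incident v c → onV v →ₗ[S] onE c

attribute [instance] CellSheaf.acmV CellSheaf.acmE CellSheaf.modV CellSheaf.modE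

namespace CellSheaf

variable {S : Type u} [CommSemiring S] {V E : Type*} {X : DiGraph V E}

/-- A sheaf is flat if all its stalks are flat. -/
def Flat (F : CellSheaf.{u, w} S X) : Prop :=
  (∀ v, FlatSemimodule.{u, w} S (F.onV v)) ∧ ∀ c, FlatSemimodule.{u, w} S (F.onE c)

/-- A natural transformation from `F` to the constant sheaf at `M`. -/
structure HomToConst (F : CellSheaf.{u, w} S X) (M : Type v) [AddCommMonoid M] [Module S M] where
  onV : ∀ v, F.onV v →ₗ[S] M
  onE : ∀ c, F.onE c →ₗ[S] M
  naturality : ∀ (v : V) (c : E) (h : X.Incident v c) (x : F.onV v),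
    onE c (F.res v c h x) = onV v x

/-- An `F`-flow: for every edge `c` a section of `F` over the closure of `c` (a value at each
endpoint of `c`, the values having the same restriction to `c`), such that at every vertex the
outgoing and the incoming values have the same sum. -/
structure SheafFlow [Fintype E] (F : CellSheaf.{u, w} S X) where
  val : ∀ (v : V) (c : E), X.Incident v c → F.onV v
  compat : ∀ (v v' : V) (c : E) (h : X.Incident v c) (h' : X.Incident v' c),
    F.res v c h (val v c h) = F.res v' c h' (val v' c h')
  conserve : ∀ v : V,
    open scoped Classical in
    (∑ c : {c : E // X.src c = v}, val v c.1 (Or.inl c.2.symm)) =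
      ∑ c : {c : E // X.tgt c = v}, val v c.1 (Or.inr c.2.symm)

end CellSheaf

/-- `φ` is (locally) `S`-decomposable: it is the image of an `F`-flow under a natural
transformation from a flat `S`-sheaf `F` on `X`. -/
def IsDecomposable (S : Type u) [CommSemiring S] {V E : Type*} [Fintype E] {M : Type v}
    [AddCommMonoid M] [Module S M] (X : DiGraph V E) (φ : E → M) : Prop :=
  ∃ (F : CellSheaf.{u, v} S X) (_ : F.Flat) (τ : F.HomToConst M) (s : F.SheafFlow),
    ∀ (v : V) (c : E) (h : X.Incident v c), τ.onV v (s.val v c h) = φ c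

/-- The values at `e` of the `S`-decomposable flows on `(X; ω)`.  The digraph being finite, all
flows are finite. -/
def flowValues (S : Type u) [CommSemiring S] {V E : Type*} [Fintype E] {M : Type v}
    [AddCommMonoid M] [Module S M] (X : DiGraph V E) (ω : E → M) (e : E) : Set M :=
  {x | ∃ φ : E → M, IsFlow X ω φ ∧ IsDecomposable S X φ ∧ φ e = x}

end AlgMFMC

/-! Upper bound. Let `A` contain the target of `e` but not its source. No directed loop runs inside
`A`, so `A` can be dismantled one sink at a time. Conservation then shows, by additions alone (`M`
need not be cancellative), that as much enters `A` as leaves it: `sum_entering_eq_sum_leaving`.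
Since `e` enters `A`, the value at `e` is at most the capacity of the cut.

Attainment, by reduction to integers. Suppose that every `ω c` is written as `∑ k, t c k • h k` in
such a way that the meet of the cut capacities is computed coefficientwise, with coefficients `μ k`.
For each `k`, integer max-flow min-cut (`exists_circulation`) gives a circulation `f k` below `t ·
k` with value `μ k` at `e`, and `∑ k, f k · • h k` is an optimal flow. It is decomposable through
the constant sheaf with free stalk `S^κ`.

Such elements `h` exist (`exists_common_refinement`). Write two `ℕ`-linear forms as their common
part plus two excesses. If a generator of one excess meets a generator of the other in some `d` that
the common part does not absorb, split `d` off both; part of the disagreement cancels, and this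
process stops. Once no such pair remains, distributivity of `+` over `⊓` makes the meet equal to the
common part. -/

namespace AlgMFMC

/-! ### Refinements that make meets of `ℕ`-linear forms coefficientwise. -/

section Refinement

variable {M : Type*} [AddCommMonoid M] [SemilatticeInf M] [CanonicallyOrderedAdd M]
  [IsOrderedAddMonoid M]

omit [IsOrderedAddMonoid M] in
theorem absorb_of_le_left {W W' k : M} (h : W ≤ W') (hk : W + k = W) : W' + k = W' := by
  obtain ⟨z, rfl⟩ := exists_add_of_le h
  rw [add_right_comm, hk]

theorem absorb_of_le_right {W k k' : M} (h : k' ≤ k) (hk : W + k = W) : W + k' = W :=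
  le_antisymm ((add_le_add_right h W).trans hk.le) le_self_add

omit [SemilatticeInf M] [CanonicallyOrderedAdd M] [IsOrderedAddMonoid M] in
theorem absorb_add {W k k' : M} (hk : W + k = W) (hk' : W + k' = W) : W + (k + k') = W := by
  rw [← add_assoc, hk, hk']

omit [IsOrderedAddMonoid M] in
theorem zero_inf_eq_zero (x : M) : 0 ⊓ x = 0 :=
  le_antisymm inf_le_left (by simp)

-- The right side expands to the meet of `x + x`, `x + z`, `y + x` and `y + z`; the first three lie
-- above `x`.
omit [IsOrderedAddMonoid M] in
theorem inf_add_le_add_inf (hM : ∀ x y z : M, (x ⊓ y) + z = (x + z) ⊓ (y + z)) (x y z : M) :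
    x ⊓ (y + z) ≤ x ⊓ y + x ⊓ z := by
  rw [hM, add_comm y (x ⊓ z), add_comm x (x ⊓ z), hM, hM]
  refine le_inf (inf_le_left.trans (le_inf le_self_add le_add_self)) (le_inf ?_ ?_)
  · exact inf_le_left.trans le_self_add
  · rw [add_comm z]
    exact inf_le_right

theorem absorb_inf_sum (hM : ∀ x y z : M, (x ⊓ y) + z = (x + z) ⊓ (y + z)) {ι : Type*}
    {W x : M} (s : Finset ι) (y : ι → M) (h : ∀ i ∈ s, W + x ⊓ y i = W) :
    W + x ⊓ ∑ i ∈ s, y i = W := by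
  refine Finset.sum_induction y (fun z => W + x ⊓ z = W) ?_ ?_ h
  · intro p q hp hq
    exact absorb_of_le_right (inf_add_le_add_inf hM x p q) (absorb_add hp hq)
  · rw [inf_comm, zero_inf_eq_zero, add_zero]

theorem absorb_inf_nsmul (hM : ∀ x y z : M, (x ⊓ y) + z = (x + z) ⊓ (y + z))
    {W x y : M} (n : ℕ) (h : W + x ⊓ y = W) : W + x ⊓ (n • y) = W := by
  have := absorb_inf_sum hM (Finset.range n) (fun _ => y) (fun _ _ => h)
  simpa using this

variable {ι : Type} [Fintype ι]

/-- The coefficientwise minimum of two `ℕ`-linear forms, evaluated at `g`. -/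
def minForm (g : ι → M) (a b : ι → ℕ) : M := ∑ i, min (a i) (b i) • g i

/-- The two forms `a`, `b` disagree about `i` and `j`, and `g i ⊓ g j` is not negligible with
respect to the common part of the two forms. -/
def IsCrossing (g : ι → M) (a b : ι → ℕ) (i j : ι) : Prop :=
  b i < a i ∧ a j < b j ∧ minForm g a b + g i ⊓ g j ≠ minForm g a b

/-- The two forms `a` and `b` have their meet computed coefficientwise, after writing the `g i` as
combinations of finitely many elements. -/
def MinResolvable (g : ι → M) (a b : ι → ℕ) : Prop :=
  ∃ (κ : Type) (_ : Fintype κ) (h : κ → M) (t : ι → κ → ℕ),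
    (∀ i, g i = ∑ k, t i k • h k) ∧
    (∑ i, a i • g i) ⊓ (∑ i, b i • g i) ≤
      minForm h (fun k => ∑ i, a i * t i k) (fun k => ∑ i, b i * t i k)

/-- The family itself serves as refinement. The meet is the common part plus the meet of the two
excesses. By subadditivity of `⊓` the latter is absorbed as soon as each `g i ⊓ g j` is, with `i`
and `j` from opposite excesses. -/
theorem minResolvable_of_no_crossing (hM : ∀ x y z : M, (x ⊓ y) + z = (x + z) ⊓ (y + z))
    (g : ι → M) (a b : ι → ℕ) (h : ∀ i j, ¬ IsCrossing g a b i j) : MinResolvable g a b := by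
  classical
  refine ⟨ι, inferInstance, g, fun i j => if i = j then 1 else 0, fun i => by simp, ?_⟩
  simp only [mul_ite, mul_one, mul_zero, Finset.sum_ite_eq', Finset.mem_univ, if_true]
  have hsplit : ∀ a b : ι → ℕ, ∑ i, a i • g i = (∑ i, (a i - b i) • g i) + minForm g a b := by
    intro a b
    rw [minForm, ← Finset.sum_add_distrib]
    refine Finset.sum_congr rfl fun i _ => ?_
    rw [← add_smul]
    congr 1
    omega
  have hcomm : minForm g b a = minForm g a b := by simp only [minForm, min_comm]
  rw [hsplit a b, hsplit b a, hcomm, ← hM, add_comm]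
  refine le_of_eq (absorb_inf_sum hM _ _ fun j _ => ?_)
  rcases Nat.lt_or_ge (a j) (b j) with hj | hj
  swap
  · rw [Nat.sub_eq_zero_of_le hj, zero_smul, inf_comm, zero_inf_eq_zero, add_zero]
  refine absorb_inf_nsmul hM _ ?_
  rw [inf_comm]
  refine absorb_inf_sum hM _ _ fun i _ => ?_
  rcases Nat.lt_or_ge (b i) (a i) with hi | hi
  swap
  · rw [Nat.sub_eq_zero_of_le hi, zero_smul, inf_comm, zero_inf_eq_zero, add_zero]
  refine absorb_inf_nsmul hM _ ?_
  rw [inf_comm]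
  by_contra hne
  exact h i j ⟨hi, hj, hne⟩

open scoped Classical in
/-- The family `g` after `g i` and `g j` have been replaced by `d + x` and `d + y`; the index of `d`
is `none`. -/
noncomputable def splitFamily (g : ι → M) (i j : ι) (d x y : M) : Option ι → M
  | none => d
  | some k => if k = i then x else if k = j then y else g k

/-- The coefficients of a form with respect to the split family. -/
def splitCoeff (a : ι → ℕ) (i j : ι) : Option ι → ℕ
  | none => a i + a j
  | some k => a k

omit [Fintype ι] [SemilatticeInf M] [CanonicallyOrderedAdd M] [IsOrderedAddMonoid M] in
open scoped Classical in
theorem eq_splitFamily_add {g : ι → M} {i j : ι} {d x y : M} (hi : g i = d + x)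
    (hj : g j = d + y) (k : ι) :
    g k = splitFamily g i j d x y (some k) + (if k = i ∨ k = j then 1 else 0) • d := by
  by_cases hki : k = i
  · subst hki
    simp [splitFamily, hi, add_comm]
  · by_cases hkj : k = j
    · subst hkj
      simp [splitFamily, hki, hj, add_comm]
    · simp [splitFamily, hki, hkj]

open scoped Classical in
theorem sum_mul_ite_or {i j : ι} (hij : i ≠ j) (c : ι → ℕ) :
    ∑ k, c k * (if k = i ∨ k = j then 1 else 0) = c i + c j := by
  have : ∀ k, c k * (if k = i ∨ k = j then 1 else 0) =
      (if k = i then c k else 0) + (if k = j then c k else 0) := by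
    intro k
    by_cases hki : k = i
    · subst hki
      simp [hij]
    · simp [hki]
  simp [this, Finset.sum_add_distrib]

omit [SemilatticeInf M] [CanonicallyOrderedAdd M] [IsOrderedAddMonoid M] in
theorem sum_smul_splitFamily {g : ι → M} {i j : ι} {d x y : M} (hij : i ≠ j) (hi : g i = d + x)
    (hj : g j = d + y) (c : ι → ℕ) :
    ∑ k, c k • g k = (c i + c j) • d + ∑ k, c k • splitFamily g i j d x y (some k) := by
  classical
  have : ∀ k, c k • g k = (c k * (if k = i ∨ k = j then 1 else 0)) • d +
      c k • splitFamily g i j d x y (some k) := by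
    intro k
    rw [mul_smul, ← smul_add, add_comm, ← eq_splitFamily_add hi hj]
  rw [Finset.sum_congr rfl fun k _ => this k, Finset.sum_add_distrib, ← Finset.sum_smul,
    sum_mul_ite_or hij]

omit [CanonicallyOrderedAdd M] [IsOrderedAddMonoid M] in
theorem minResolvable_of_split {g : ι → M} {a b : ι → ℕ} {i j : ι} {d x y : M} (hij : i ≠ j)
    (hi : g i = d + x) (hj : g j = d + y)
    (h : MinResolvable (splitFamily g i j d x y) (splitCoeff a i j) (splitCoeff b i j)) :
    MinResolvable g a b := by
  classical
  obtain ⟨κ, hκ, h, t, hg, hle⟩ := h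
  refine ⟨κ, hκ, h, fun k l => t (some k) l + (if k = i ∨ k = j then 1 else 0) * t none l,
    fun k => ?_, ?_⟩
  · rw [eq_splitFamily_add hi hj k, hg (some k)]
    have hd : d = ∑ l, t none l • h l := hg none
    conv_lhs => rw [hd]
    rw [Finset.smul_sum, ← Finset.sum_add_distrib]
    exact Finset.sum_congr rfl fun l _ => by rw [add_smul, mul_smul]
  · have hform : ∀ c : ι → ℕ, ∑ k, c k • g k =
        ∑ k, splitCoeff c i j k • splitFamily g i j d x y k := fun c => by
      rw [sum_smul_splitFamily hij hi hj, Fintype.sum_option]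
      rfl
    have hcoeff : ∀ (c : ι → ℕ) (l : κ),
        ∑ k, c k * (t (some k) l + (if k = i ∨ k = j then 1 else 0) * t none l) =
          ∑ k, splitCoeff c i j k * t k l := fun c l => by
      simp only [mul_add, ← mul_assoc]
      rw [Finset.sum_add_distrib, ← Finset.sum_mul, sum_mul_ite_or hij, Fintype.sum_option,
        add_comm]
      rfl
    rw [hform a, hform b]
    simpa only [hcoeff] using hle

/-- The disagreements at `i` and `j` have opposite signs, so adding the coefficients cancels at
least one unit: the common part gains a copy of `d`. -/
theorem minForm_add_le_minForm_split {g : ι → M} {a b : ι → ℕ} {i j : ι} {d x y : M}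
    (hij : i ≠ j) (hi : g i = d + x) (hj : g j = d + y) (hai : b i < a i) (haj : a j < b j) :
    minForm g a b + d ≤
      minForm (splitFamily g i j d x y) (splitCoeff a i j) (splitCoeff b i j) := by
  rw [minForm, sum_smul_splitFamily hij hi hj, minForm, Fintype.sum_option]
  simp only [splitCoeff]
  rw [add_right_comm, ← succ_nsmul]
  refine add_le_add_left ?_ _
  change _ ≤ _ • d
  obtain ⟨n, hn⟩ := Nat.exists_eq_add_of_le
    (show min (a i) (b i) + min (a j) (b j) + 1 ≤ min (a i + a j) (b i + b j) by omega)
  rw [hn, add_smul _ n]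
  exact le_self_add

/-- The discrepancy of the two forms at `i` and `j`. -/
def crossingSize (a b : ι → ℕ) (p : ι × ι) : ℕ := (a p.1 - b p.1) + (b p.2 - a p.2)

/-- The common part grows and the generators shrink, so every crossing after the split descends from
one before it; one through `d` descends from a crossing through `i` or `j`. The pair `(i, j)` itself
stops crossing. -/
theorem isCrossing_split {g : ι → M} {a b : ι → ℕ} {i j : ι} {x y : M}
    (hM : ∀ x y z : M, (x ⊓ y) + z = (x + z) ⊓ (y + z)) (hij : i ≠ j)
    (hi : g i = g i ⊓ g j + x) (hj : g j = g i ⊓ g j + y) (hai : b i < a i) (haj : a j < b j)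
    {p q : Option ι}
    (hpq : IsCrossing (splitFamily g i j (g i ⊓ g j) x y) (splitCoeff a i j) (splitCoeff b i j)
      p q) :
    (∃ p' q', p = some p' ∧ q = some q' ∧ IsCrossing g a b p' q' ∧ (p', q') ≠ (i, j)) ∨
    (∃ q', p = none ∧ q = some q' ∧ IsCrossing g a b i q') ∨
    (∃ p', p = some p' ∧ q = none ∧ IsCrossing g a b p' j) := by
  classical
  have hW := minForm_add_le_minForm_split (a := a) (b := b) hij hi hj hai haj
  have hle : ∀ k, splitFamily g i j (g i ⊓ g j) x y (some k) ≤ g k := fun k => by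
    conv_rhs => rw [eq_splitFamily_add hi hj k]
    exact le_self_add
  have key : ∀ p' q' : ι, ∀ u v : M, u ≤ g p' → v ≤ g q' →
      minForm (splitFamily g i j (g i ⊓ g j) x y) (splitCoeff a i j) (splitCoeff b i j) + u ⊓ v ≠
        minForm (splitFamily g i j (g i ⊓ g j) x y) (splitCoeff a i j) (splitCoeff b i j) →
      minForm g a b + g p' ⊓ g q' ≠ minForm g a b := fun p' q' u v hu hv hne h =>
    hne (absorb_of_le_right (inf_le_inf hu hv) (absorb_of_le_left (le_self_add.trans hW) h))
  obtain ⟨h1, h2, h3⟩ := hpq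
  rcases p with _ | p <;> rcases q with _ | q
  · simp only [splitCoeff] at h1 h2
    omega
  · exact Or.inr (Or.inl ⟨q, rfl, rfl, hai, h2, key i q _ _ inf_le_left (hle q) h3⟩)
  · exact Or.inr (Or.inr ⟨p, rfl, rfl, h1, haj, key p j _ _ (hle p) inf_le_right h3⟩)
  · refine Or.inl ⟨p, q, rfl, rfl, ⟨h1, h2, key p q _ _ (hle p) (hle q) h3⟩, fun hpq => h3 ?_⟩
    obtain ⟨rfl, rfl⟩ := Prod.mk.inj hpq
    -- The new common part contains `d`, and `d + x ⊓ y = (d + x) ⊓ (d + y) = d`.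
    refine absorb_of_le_left (le_add_self.trans hW) ?_
    simp only [splitFamily, if_true, if_neg hij.symm]
    rw [add_comm, hM, add_comm x, add_comm y, ← hi, ← hj]

/-- Lexicographic induction on a bound for the sizes and on the number of crossings of maximal size
`N`. The signed discrepancy at `d` is `(a i - b i) - (b j - a j)`, so a crossing through `d` is
strictly smaller than its ancestor, while the split pair disappears. -/
theorem minResolvable_of_crossing_lt (hM : ∀ x y z : M, (x ⊓ y) + z = (x + z) ⊓ (y + z)) (N : ℕ) :
    ∀ {ι : Type} [Fintype ι] (g : ι → M) (a b : ι → ℕ),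
      (∀ i j, IsCrossing g a b i j → crossingSize a b (i, j) < N) → MinResolvable g a b := by
  classical
  induction N with
  | zero =>
    intro ι _ g a b h
    exact minResolvable_of_no_crossing hM g a b fun i j hij => by simpa using h i j hij
  | succ N ihN =>
    have main : ∀ c : ℕ, ∀ {ι : Type} [Fintype ι] (g : ι → M) (a b : ι → ℕ),
        (∀ i j, IsCrossing g a b i j → crossingSize a b (i, j) < N + 1) →
        (Finset.univ.filter fun p : ι × ι =>
          IsCrossing g a b p.1 p.2 ∧ crossingSize a b p = N).card ≤ c → MinResolvable g a b := by
      intro c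
      induction c with
      | zero =>
        intro ι _ g a b h hc
        refine ihN g a b fun i j hij => lt_of_le_of_ne (Nat.lt_succ_iff.mp (h i j hij)) fun hN => ?_
        have hmem : (i, j) ∈ Finset.univ.filter fun p : ι × ι =>
            IsCrossing g a b p.1 p.2 ∧ crossingSize a b p = N := by simp [hij, hN]
        rw [Finset.card_eq_zero.mp (Nat.le_zero.mp hc)] at hmem
        simp at hmem
      | succ c ihc =>
        intro ι _ g a b h hc
        rcases (Finset.univ.filter fun p : ι × ι =>
          IsCrossing g a b p.1 p.2 ∧ crossingSize a b p = N).eq_empty_or_nonempty with he | he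
        · refine ihc g a b h ?_
          rw [he]
          simp
        obtain ⟨⟨i, j⟩, hmem⟩ := he
        have hmem' := hmem
        simp only [Finset.mem_filter, Finset.mem_univ, true_and] at hmem'
        obtain ⟨⟨hai, haj, hne⟩, hN⟩ := hmem'
        have hij : i ≠ j := by
          rintro rfl
          omega
        obtain ⟨x, hi⟩ := exists_add_of_le (inf_le_left : g i ⊓ g j ≤ g i)
        obtain ⟨y, hj⟩ := exists_add_of_le (inf_le_right : g i ⊓ g j ≤ g j)
        refine minResolvable_of_split hij hi hj (ihc _ _ _ ?_ ?_)
        · intro p q hpq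
          have h12 := And.intro hpq.1 hpq.2.1
          rcases isCrossing_split hM hij hi hj hai haj hpq with
            ⟨p, q, rfl, rfl, hc', -⟩ | ⟨q, rfl, rfl, hc'⟩ | ⟨p, rfl, rfl, hc'⟩
          · exact h p q hc'
          · have := h i q hc'
            simp only [crossingSize, splitCoeff] at this h12 ⊢
            omega
          · have := h p j hc'
            simp only [crossingSize, splitCoeff] at this h12 ⊢
            omega
        · refine Nat.le_of_lt_succ (lt_of_lt_of_le ?_ hc)
          refine lt_of_le_of_lt ?_ (Finset.card_erase_lt_of_mem hmem)
          -- Crossings of size `N` that survive avoid `d`, hence come from old ones other than `(i,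
          -- j)`.
          refine (Finset.card_le_card (t := (Finset.erase _ (i, j)).image
            (Prod.map some some)) ?_).trans Finset.card_image_le
          rintro ⟨p, q⟩ hpq
          simp only [Finset.mem_filter, Finset.mem_univ, true_and] at hpq
          obtain ⟨hpq, hsize⟩ := hpq
          have h12 := And.intro hpq.1 hpq.2.1
          rcases isCrossing_split hM hij hi hj hai haj hpq with
            ⟨p, q, rfl, rfl, hc', hne'⟩ | ⟨q, rfl, rfl, hc'⟩ | ⟨p, rfl, rfl, hc'⟩
          · refine Finset.mem_image.mpr ⟨(p, q), ?_, rfl⟩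
            simp only [Finset.mem_erase, Finset.mem_filter, Finset.mem_univ, true_and]
            exact ⟨hne', hc', hsize⟩
          · have := h i q hc'
            simp only [crossingSize, splitCoeff] at this h12 hsize
            omega
          · have := h p j hc'
            simp only [crossingSize, splitCoeff] at this h12 hsize
            omega
    intro ι _ g a b h
    exact main _ g a b h le_rfl

/-- Any two `ℕ`-linear forms have their meet computed coefficientwise after a refinement. -/
theorem minResolvable (hM : ∀ x y z : M, (x ⊓ y) + z = (x + z) ⊓ (y + z)) (g : ι → M)
    (a b : ι → ℕ) : MinResolvable g a b := by
  refine minResolvable_of_crossing_lt hM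
    ((Finset.univ.sup fun p : ι × ι => crossingSize a b p) + 1) g a b fun i j _ => ?_
  exact Nat.lt_succ_of_le
    (Finset.le_sup (f := fun p : ι × ι => crossingSize a b p) (Finset.mem_univ (i, j)))

/-- Finitely many `ℕ`-linear forms have their meet computed coefficientwise after a refinement. -/
theorem exists_common_refinement (hM : ∀ x y z : M, (x ⊓ y) + z = (x + z) ⊓ (y + z))
    {E : Type*} [Fintype E] (g : E → M) {F : Finset (E → ℕ)} (hF : F.Nonempty) :
    ∃ (κ : Type) (_ : Fintype κ) (h : κ → M) (t : E → κ → ℕ) (μ : κ → ℕ),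
      (∀ c, g c = ∑ k, t c k • h k) ∧ (∀ n ∈ F, ∀ k, μ k ≤ ∑ c, n c * t c k) ∧
      ∀ z : M, (∀ n ∈ F, z ≤ ∑ c, n c • g c) → z ≤ ∑ k, μ k • h k := by
  classical
  induction hF using Finset.Nonempty.cons_induction with
  | singleton n =>
    -- The enumeration only serves to place the index set in `Type`.
    let r := Fintype.equivFin E
    refine ⟨Fin (Fintype.card E), inferInstance, g ∘ r.symm, fun c k => if r c = k then 1 else 0,
      n ∘ r.symm, fun c => by simp, ?_, ?_⟩
    · intro n' hn' k
      rw [Finset.mem_singleton] at hn'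
      subst hn'
      refine le_of_eq ?_
      rw [← Equiv.sum_comp r.symm]
      simp
    · intro z hz
      refine (hz n (Finset.mem_singleton_self n)).trans (le_of_eq ?_)
      rw [← Equiv.sum_comp r.symm]
      rfl
  | cons n F hn hF ih =>
    obtain ⟨κ, _, h, t, μ, hg, hμ, hz⟩ := ih
    -- `μ` is the running meet. Refining by the natural numbers `t'` keeps it below the earlier
    -- forms.
    obtain ⟨κ', _, h', t', hh, hle⟩ := minResolvable hM h μ (fun k => ∑ c, n c * t c k)
    have hassoc : ∀ (n : E → ℕ) (l : κ'), ∑ k, (∑ c, n c * t c k) * t' k l =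
        ∑ c, n c * ∑ k, t c k * t' k l := fun n l => by
      simp only [Finset.sum_mul, Finset.mul_sum, mul_assoc]
      exact Finset.sum_comm
    have hexp : ∀ (c : E), g c = ∑ l, (∑ k, t c k * t' k l) • h' l := fun c => by
      rw [hg c]
      simp only [Finset.sum_smul]
      rw [Finset.sum_comm]
      refine Finset.sum_congr rfl fun k _ => ?_
      conv_lhs => rw [hh k]
      rw [Finset.smul_sum]
      exact Finset.sum_congr rfl fun l _ => by rw [mul_smul]
    refine ⟨κ', inferInstance, h', fun c l => ∑ k, t c k * t' k l,
      fun l => min (∑ k, μ k * t' k l) (∑ k, (∑ c, n c * t c k) * t' k l), hexp, ?_, ?_⟩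
    · intro n' hn' l
      rcases Finset.mem_cons.mp hn' with rfl | hn'
      · exact (min_le_right _ _).trans (hassoc n' l).le
      · refine (min_le_left _ _).trans (le_trans ?_ (hassoc n' l).le)
        exact Finset.sum_le_sum fun k _ => Nat.mul_le_mul_right _ (hμ n' hn' k)
    · intro z hz'
      refine le_trans (le_inf (hz z fun n' hn' => hz' n' (Finset.mem_cons_of_mem hn')) ?_) hle
      refine (hz' n (Finset.mem_cons_self _ _)).trans (le_of_eq ?_)
      simp only [Finset.sum_smul, mul_smul]
      rw [Finset.sum_comm]
      refine Finset.sum_congr rfl fun c _ => ?_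
      conv_lhs => rw [hg c]
      rw [Finset.smul_sum]

end Refinement

/-! ### Free stalks and decomposability. -/

section Flat

universe u v w

variable {S : Type u} [CommSemiring S]

/-- A semimodule with a finite basis is flat. -/
theorem flatSemimodule_of_equiv_pi {κ : Type*} [Fintype κ] {F : Type (max u w)}
    [AddCommMonoid F] [Module S F] (r : F ≃ₗ[S] (κ → S)) : FlatSemimodule.{u, w} S F := by
  classical
  intro A B _ _ _ _ f g
  -- `F ⊗ N` is `N^κ`, naturally in `N`, and equalizers of powers are coordinatewise.
  let Φ : ∀ (N : Type (max u w)) [AddCommMonoid N] [Module S N], F ⊗[S] N ≃ₗ[S] (κ → N) :=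
    fun N _ _ => (TensorProduct.comm S F N).trans
      ((TensorProduct.congr (LinearEquiv.refl S N) r).trans
        (TensorProduct.piScalarRight S S N κ))
  have hΦ : ∀ (N N' : Type (max u w)) [AddCommMonoid N] [Module S N] [AddCommMonoid N']
      [Module S N'] (p : N →ₗ[S] N') (t : F ⊗[S] N) (k : κ),
      Φ N' (LinearMap.lTensor F p t) k = p (Φ N t k) := by
    intro N N' _ _ _ _ p t k
    induction t using TensorProduct.induction_on with
    | zero => simp
    | tmul x y => simp [Φ]
    | add x y hx hy => simp only [map_add, Pi.add_apply, hx, hy]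
  constructor
  · intro t t' h
    refine (Φ _).injective (funext fun k => Subtype.ext ?_)
    have := congrArg (fun z => Φ A z k) h
    simp only [hΦ] at this
    exact this
  · intro t ht
    have hmem : ∀ k, Φ A t k ∈ LinearMap.eqLocus f g := fun k => by
      have := congrArg (fun z => Φ B z k) ht
      simp only [hΦ] at this
      exact this
    refine ⟨(Φ _).symm fun k => ⟨Φ A t k, hmem k⟩, (Φ A).injective (funext fun k => ?_)⟩
    rw [hΦ, LinearEquiv.apply_symm_apply]
    rfl

/-- A combination of circulations with values in `ℕ` is decomposable. -/
theorem isDecomposable_sum_smul {V : Type*} {E : Type*} [Fintype E] {M : Type v} [AddCommMonoid M]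
    [Module S M] (X : DiGraph V E) {κ : Type} [Fintype κ] (f : κ → E → ℕ) (h : κ → M)
    (hf : ∀ (k : κ) (v : V), open scoped Classical in
      (∑ c : {c : E // X.src c = v}, f k c.1) = ∑ c : {c : E // X.tgt c = v}, f k c.1) :
    IsDecomposable S X (fun c => ∑ k, f k c • h k) := by
  classical
  have hflat : FlatSemimodule.{u, v} S (ULift.{v} (κ → S)) :=
    flatSemimodule_of_equiv_pi (ULift.moduleEquiv : ULift.{v} (κ → S) ≃ₗ[S] (κ → S))
  let τ : ULift.{v} (κ → S) →ₗ[S] M :=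
    (Fintype.linearCombination S h).comp
      (ULift.moduleEquiv : ULift.{v} (κ → S) ≃ₗ[S] (κ → S)).toLinearMap
  refine ⟨{ onV := fun _ => ULift.{v} (κ → S)
            onE := fun _ => ULift.{v} (κ → S)
            res := fun _ _ _ => LinearMap.id }, ⟨fun _ => hflat, fun _ => hflat⟩,
    { onV := fun _ => τ, onE := fun _ => τ, naturality := fun _ _ _ _ => rfl },
    { val := fun _ c _ => ULift.up fun k => (f k c : S)
      compat := fun _ _ _ _ _ => rfl
      conserve := fun v => ?_ }, fun v c _ => ?_⟩
  · apply (ULift.moduleEquiv : ULift.{v} (κ → S) ≃ₗ[S] (κ → S)).injective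
    ext k
    simp only [map_sum, Finset.sum_apply, ULift.moduleEquiv_apply]
    exact_mod_cast congrArg (Nat.cast : ℕ → S) (hf k v)
  · simp [τ, Fintype.linearCombination_apply, Nat.cast_smul_eq_nsmul]

end Flat

/-! ### Conservation across a vertex set. -/

section WeakDuality

variable {V E : Type*} {X : DiGraph V E}

/-- If `X - e` is acyclic, a finite vertex set such that `e` does not start in it has a vertex from
which no edge leads into the set. -/
theorem DiGraph.AcyclicWithout.exists_sink {e : E} (hX : X.AcyclicWithout e) {B : Finset V}
    (hB : B.Nonempty) (he : X.src e ∉ B) : ∃ v ∈ B, ∀ c, X.src c = v → X.tgt c ∉ B := by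
  by_contra! hcon
  choose σ hsrc htgt using fun v : B => hcon v.1 v.2
  let next : B → B := fun v => ⟨X.tgt (σ v), htgt v⟩
  -- On its periodic points the successor map is bijective, so these points and their chosen edges
  -- form a directed loop.
  have hbij := Function.bijOn_periodicPts next
  obtain ⟨v₀, hv₀⟩ := hB
  have hne : (Function.periodicPts next).Nonempty := by
    obtain ⟨m, n, hmn, heq⟩ :=
      Finite.exists_ne_map_eq_of_infinite (fun n : ℕ => next^[n] ⟨v₀, hv₀⟩)
    wlog hlt : m < n generalizing m n
    · exact this n m hmn.symm heq.symm (by omega)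
    refine ⟨next^[m] ⟨v₀, hv₀⟩, Function.mk_mem_periodicPts (Nat.sub_pos_of_lt hlt) ?_⟩
    change next^[n - m] (next^[m] ⟨v₀, hv₀⟩) = next^[m] ⟨v₀, hv₀⟩
    rw [← Function.iterate_add_apply, Nat.sub_add_cancel hlt.le]
    exact heq.symm
  have hloop : X.IsDirectedLoop (Subtype.val '' Function.periodicPts next)
      (σ '' Function.periodicPts next) := by
    refine ⟨hne.image _, ?_, ?_⟩
    · rintro c ⟨w, hw, rfl⟩
      exact ⟨⟨w, hw, (hsrc w).symm⟩, ⟨next w, hbij.mapsTo hw, rfl⟩⟩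
    · rintro v ⟨w, hw, rfl⟩
      constructor
      · refine ⟨σ w, ⟨⟨w, hw, rfl⟩, hsrc w⟩, ?_⟩
        rintro c ⟨⟨w', hw', rfl⟩, h⟩
        rw [hsrc] at h
        rw [Subtype.ext h]
      · obtain ⟨w', hw', rfl⟩ := hbij.surjOn hw
        refine ⟨σ w', ⟨⟨w', hw', rfl⟩, rfl⟩, ?_⟩
        rintro c ⟨⟨w'', hw'', rfl⟩, h⟩
        rw [hbij.injOn hw'' hw' (Subtype.ext h)]
  obtain ⟨w, -, hw⟩ := hX _ _ hloop
  apply he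
  rw [← hw, hsrc]
  exact w.2

variable {M : Type*} [AddCommMonoid M] [Fintype E]

open scoped Classical in
theorem sum_subtype_eq_sum_ite (p : E → Prop) (φ : E → M) :
    ∑ c : {c // p c}, φ c.1 = ∑ c, if p c then φ c else 0 := by
  rw [← Finset.sum_filter]
  exact (Finset.sum_subtype _ (by simp) φ).symm

open scoped Classical in
/-- A conserved function enters and leaves a vertex set with the same sum, if no directed loop
runs inside the set. -/
theorem sum_entering_eq_sum_leaving {e : E} (hX : X.AcyclicWithout e) {φ : E → M}
    (hφ : ∀ v, ∑ c : {c : E // X.src c = v}, φ c.1 = ∑ c : {c : E // X.tgt c = v}, φ c.1)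
    (n : ℕ) : ∀ B : Finset V, B.card = n → X.src e ∉ B →
      (∑ c, if X.src c ∉ B ∧ X.tgt c ∈ B then φ c else 0) =
        ∑ c, if X.src c ∈ B ∧ X.tgt c ∉ B then φ c else 0 := by
  induction n with
  | zero =>
    intro B hB _
    rw [Finset.card_eq_zero] at hB
    simp [hB]
  | succ n ih =>
    intro B hB he
    -- Every edge out of the sink `v` leaves `B`, so conservation at `v` trades its outgoing sum for
    -- its incoming one when `v` is removed.
    obtain ⟨v, hv, hsink⟩ := hX.exists_sink (Finset.card_pos.mp (by omega)) he
    have ih' := ih (B.erase v) (by rw [Finset.card_erase_of_mem hv, hB]; rfl)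
      (fun h => he (Finset.mem_of_mem_erase h))
    have hcons := hφ v
    rw [sum_subtype_eq_sum_ite, sum_subtype_eq_sum_ite] at hcons
    have h1 : (∑ c, if X.src c ∉ B ∧ X.tgt c ∈ B then φ c else 0) =
        (∑ c, if X.src c ∉ B.erase v ∧ X.tgt c ∈ B.erase v then φ c else 0) +
          ∑ c, if X.src c ∉ B ∧ X.tgt c = v then φ c else 0 := by
      rw [← Finset.sum_add_distrib]
      refine Finset.sum_congr rfl fun c _ => ?_
      have := hsink c
      simp only [Finset.mem_erase]
      by_cases h : X.tgt c = v
      · simp [h, hv]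
      · by_cases h' : X.src c = v
        · simp [h, h', this h']
        · simp [h, h']
    have h2 : (∑ c, if X.src c ∈ B.erase v ∧ X.tgt c ∉ B.erase v then φ c else 0) =
        (∑ c, if X.src c ∈ B.erase v ∧ X.tgt c ∉ B then φ c else 0) +
          ∑ c, if X.src c ∈ B ∧ X.tgt c = v then φ c else 0 := by
      rw [← Finset.sum_add_distrib]
      refine Finset.sum_congr rfl fun c _ => ?_
      have := hsink c
      simp only [Finset.mem_erase]
      by_cases h : X.tgt c = v
      · by_cases h' : X.src c = v
        · exact absurd (h ▸ hv) (this h')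
        · simp [h, h', hv]
      · simp [h]
    have h3 : (∑ c, if X.tgt c = v then φ c else 0) =
        (∑ c, if X.src c ∈ B ∧ X.tgt c = v then φ c else 0) +
          ∑ c, if X.src c ∉ B ∧ X.tgt c = v then φ c else 0 := by
      rw [← Finset.sum_add_distrib]
      refine Finset.sum_congr rfl fun c _ => ?_
      by_cases h : X.src c ∈ B <;> simp [h]
    have h4 : (∑ c, if X.src c ∈ B ∧ X.tgt c ∉ B then φ c else 0) =
        (∑ c, if X.src c ∈ B.erase v ∧ X.tgt c ∉ B then φ c else 0) +
          ∑ c, if X.src c = v then φ c else 0 := by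
      rw [← Finset.sum_add_distrib]
      refine Finset.sum_congr rfl fun c _ => ?_
      have := hsink c
      by_cases h : X.src c = v
      · simp [h, hv, this h]
      · simp [h]
    rw [h1, ih', h2, h4, hcons, h3, add_assoc]

end WeakDuality

/-! ### Integer max-flow min-cut by augmenting paths. -/

section IntegerFlows

variable {V E : Type*} (X : DiGraph V E)

open scoped Classical in
/-- The outgoing minus the incoming sum at a vertex. -/
noncomputable def divergence [Fintype E] (f : E → ℤ) (v : V) : ℤ :=
  ∑ c, ((if X.src c = v then f c else 0) - (if X.tgt c = v then f c else 0))

/-- One unit of `f` can be sent from `x` to `y` along an edge other than `e`, respecting the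
capacities `t`. -/
def Residual (e : E) (t f : E → ℤ) (x y : V) : Prop :=
  ∃ c, c ≠ e ∧ ((X.src c = x ∧ X.tgt c = y ∧ f c < t c) ∨
    (X.tgt c = x ∧ X.src c = y ∧ 0 < f c))

variable [Fintype E]

/-- `d` plays the distance to `y` in the residual graph, and the unit descends one level per step.
Steps are required only from levels at most `n`: the edge just used started one level higher, so its
change destroys none of the steps still needed. -/
theorem exists_push (e : E) (t : E → ℤ) (d : V → ℕ) (y : V) (n : ℕ) :
    ∀ (f : E → ℤ) (x : V), (∀ c, 0 ≤ f c ∧ f c ≤ t c) → d x = n →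
      (∀ z, d z ≤ n → d z = 0 → z = y) →
      (∀ z, d z ≤ n → d z ≠ 0 → ∃ z', d z' + 1 = d z ∧ Residual X e t f z z') →
      ∃ f' : E → ℤ, (∀ c, 0 ≤ f' c ∧ f' c ≤ t c) ∧ f' e = f e ∧ ∀ v,
        open scoped Classical in
        divergence X f' v = divergence X f v + (if v = x then 1 else 0) - (if v = y then 1 else 0) := by
  classical
  induction n with
  | zero =>
    intro f x hf hx h0 _
    obtain rfl := h0 x hx.le hx
    exact ⟨f, hf, rfl, fun v => by ring⟩
  | succ n ih =>
    intro f x hf hx h0 hstep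
    obtain ⟨z, hz, c, hce, hc⟩ := hstep x hx.le (by omega)
    obtain ⟨s, hs, hcap, hres, hdiv⟩ : ∃ s : ℤ, (s = 1 ∨ s = -1) ∧
        (0 ≤ f c + s ∧ f c + s ≤ t c) ∧
        (∀ u w, d u ≤ n → d w + 1 = d u → Residual X e t f u w →
          Residual X e t (Function.update f c (f c + s)) u w) ∧
        ∀ v, (if X.src c = v then s else 0) - (if X.tgt c = v then s else 0) =
          (if v = x then 1 else 0) - (if v = z then 1 else 0) := by
      have := hf c
      rcases hc with ⟨h1, h2, h3⟩ | ⟨h1, h2, h3⟩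
      · refine ⟨1, Or.inl rfl, by omega, ?_, fun v => by simp [h1, h2, eq_comm]⟩
        rintro u w hu hw ⟨c', hc', h⟩
        refine ⟨c', hc', ?_⟩
        by_cases hcc : c' = c
        · subst hcc
          rcases h with ⟨h, h', h''⟩ | ⟨h, h', h''⟩
          · exfalso
            rw [← h, h1] at hu
            omega
          · refine Or.inr ⟨h, h', ?_⟩
            simp
            omega
        · simpa [hcc] using h
      · refine ⟨-1, Or.inr rfl, by omega, ?_, fun v => ?_⟩
        · rintro u w hu hw ⟨c', hc', h⟩
          refine ⟨c', hc', ?_⟩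
          by_cases hcc : c' = c
          · subst hcc
            rcases h with ⟨h, h', h''⟩ | ⟨h, h', h''⟩
            · refine Or.inl ⟨h, h', ?_⟩
              simp
              omega
            · exfalso
              rw [← h, h1] at hu
              omega
          · simpa [hcc] using h
        · simp only [h1, h2, eq_comm (a := x), eq_comm (a := z)]
          split_ifs <;> rfl
    obtain ⟨f', hf', he', hdiv'⟩ := ih (Function.update f c (f c + s)) z (by
        intro c'
        by_cases hcc : c' = c
        · subst hcc
          simpa using hcap
        · simpa [hcc] using hf c') (by omega) (fun u hu => h0 u (by omega)) (by
        intro u hu hu0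
        obtain ⟨w, hw, hr⟩ := hstep u (by omega) hu0
        exact ⟨w, hw, hres u w hu hw hr⟩)
    refine ⟨f', hf', by rw [he']; simp [hce.symm], fun v => ?_⟩
    have hupd : divergence X (Function.update f c (f c + s)) v = divergence X f v +
        ((if X.src c = v then s else 0) - (if X.tgt c = v then s else 0)) := by
      have : ∀ c', ((if X.src c' = v then Function.update f c (f c + s) c' else 0) -
          (if X.tgt c' = v then Function.update f c (f c + s) c' else 0)) =
          ((if X.src c' = v then f c' else 0) - (if X.tgt c' = v then f c' else 0)) +
          (if c' = c then
            ((if X.src c = v then s else 0) - (if X.tgt c = v then s else 0)) else 0) := by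
        intro c'
        by_cases hcc : c' = c
        · subst hcc
          simp only [Function.update_self, if_true]
          split_ifs <;> ring
        · simp [hcc]
      simp only [divergence, this]
      rw [Finset.sum_add_distrib]
      simp
    rw [hdiv', hupd, hdiv]
    ring

open scoped Classical in
theorem sum_divergence (A : Finset V) (f : E → ℤ) :
    ∑ v ∈ A, divergence X f v =
      (∑ c, if X.src c ∈ A ∧ X.tgt c ∉ A then f c else 0) -
        ∑ c, if X.src c ∉ A ∧ X.tgt c ∈ A then f c else 0 := by
  simp only [divergence]
  rw [Finset.sum_comm, ← Finset.sum_sub_distrib]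
  refine Finset.sum_congr rfl fun c _ => ?_
  rw [Finset.sum_sub_distrib]
  simp only [Finset.sum_ite_eq]
  by_cases h1 : X.src c ∈ A <;> by_cases h2 : X.tgt c ∈ A <;> simp [h1, h2]

/-- Max-flow min-cut for integer capacities. -/
theorem exists_circulation [Finite V] (e : E) (t : E → ℕ) (μ : ℕ)
    (hμ : ∀ C : Finset E, X.IsEdgeCut e C → μ ≤ ∑ c ∈ C, t c) :
    ∃ f : E → ℕ, (∀ c, f c ≤ t c) ∧ f e = μ ∧ ∀ v : V, open scoped Classical in
      (∑ c : {c : E // X.src c = v}, f c.1) = ∑ c : {c : E // X.tgt c = v}, f c.1 := by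
  classical
  have hμe : μ ≤ t e := by simpa using hμ {e} (Or.inl rfl)
  have main : ∀ k : ℕ, k ≤ μ → ∃ f : E → ℤ, (∀ c, 0 ≤ f c ∧ f c ≤ t c) ∧ f e = k ∧
      ∀ v, divergence X f v = 0 := by
    intro k
    induction k with
    | zero => exact fun _ => ⟨0, fun c => by simp, rfl, fun v => by simp [divergence]⟩
    | succ k ih =>
      intro hk
      obtain ⟨f, hf, hfe, hdiv⟩ := ih (by omega)
      -- `L n x`: the source of `e` can be reached from `x` in `n` residual steps.
      let L : ℕ → V → Prop := fun n =>
        Nat.rec (motive := fun _ => V → Prop) (fun x => x = X.src e)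
          (fun _ P x => ∃ y, P y ∧ Residual X e (fun c => t c) f x y) n
      by_cases hreach : ∃ n, L n (X.tgt e)
      · have hsrc : ∃ n, L n (X.src e) := ⟨0, rfl⟩
        -- The default value puts vertices that do not reach the source beyond all levels used by
        -- `exists_push`.
        let d : V → ℕ := fun x => if h : ∃ n, L n x then Nat.find h else Nat.find hreach + 1
        have hd : ∀ x (h : ∃ n, L n x), L (d x) x := fun x h => by
          simp only [d, dif_pos h]
          exact Nat.find_spec h
        have hdle : ∀ x n, L n x → d x ≤ n := fun x n h => by
          simp only [d, dif_pos (⟨n, h⟩ : ∃ n, L n x)]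
          exact Nat.find_min' _ h
        have hdr : ∀ x, d x ≤ d (X.tgt e) → ∃ n, L n x := fun x hx => by
          by_contra hno
          simp only [d, dif_neg hno, dif_pos hreach] at hx
          omega
        obtain ⟨f', hf', hfe', hdiv'⟩ := exists_push X e (fun c => t c) d (X.src e)
          (d (X.tgt e)) f (X.tgt e) hf rfl (fun z hz hz0 => by
            have := hd z (hdr z hz)
            rw [hz0] at this
            exact this) (fun z hz hz0 => by
            have := hd z (hdr z hz)
            obtain ⟨m, hm⟩ := Nat.exists_eq_succ_of_ne_zero hz0
            rw [hm] at this
            obtain ⟨y, hy, hr⟩ := this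
            refine ⟨y, ?_, hr⟩
            have h1 := hdle y m hy
            have h2 := hdle z (d y + 1) ⟨y, hd y ⟨m, hy⟩, hr⟩
            omega)
        -- One more unit on `e` closes the pushed path into a cycle; there is room because `k + 1 ≤
        -- μ ≤ t e`.
        refine ⟨Function.update f' e (k + 1), fun c => ?_, by simp, fun v => ?_⟩
        · by_cases hce : c = e
          · subst hce
            simp
            omega
          · simpa [hce] using hf' c
        · have : ∀ c, ((if X.src c = v then Function.update f' e (k + 1 : ℤ) c else 0) -
              (if X.tgt c = v then Function.update f' e (k + 1 : ℤ) c else 0)) =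
              ((if X.src c = v then f' c else 0) - (if X.tgt c = v then f' c else 0)) +
              (if c = e then
                ((if X.src e = v then 1 else 0) - (if X.tgt e = v then 1 else 0)) else 0) := by
            intro c
            by_cases hce : c = e
            · subst hce
              simp only [Function.update_self, if_true, hfe', hfe]
              split_ifs <;> ring
            · simp [hce]
          simp only [divergence, this]
          rw [Finset.sum_add_distrib]
          have h := hdiv' v
          simp only [divergence] at h hdiv
          rw [h, hdiv v]
          simp [eq_comm (a := v)]
      · exfalso
        let _ := Fintype.ofFinite V
        -- Edges leaving `A` are saturated and edges entering it, except `e`, are empty; the cut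
        -- would have capacity `k < μ`.
        let A : Finset V := Finset.univ.filter fun x => ¬ ∃ n, L n x
        have hA : ∀ x, x ∈ A ↔ ¬ ∃ n, L n x := fun x => by simp [A]
        have hback : ∀ x y, (∃ n, L n y) → Residual X e (fun c => t c) f x y → ∃ n, L n x :=
          fun x y ⟨n, hn⟩ hr => ⟨n + 1, y, hn, hr⟩
        have hsA : X.src e ∉ A := fun h => (hA _).mp h ⟨0, rfl⟩
        have htA : X.tgt e ∈ A := (hA _).mpr hreach
        have hout : ∀ c, X.src c ∈ A → X.tgt c ∉ A → f c = t c := by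
          intro c h1 h2
          by_contra hne
          rw [hA, not_not] at h2
          refine (hA _).mp h1 (hback _ _ h2 ⟨c, ?_, Or.inl ⟨rfl, rfl, lt_of_le_of_ne (hf c).2 hne⟩⟩)
          rintro rfl
          exact hsA h1
        have hin : ∀ c, X.src c ∉ A → X.tgt c ∈ A → c ≠ e → f c = 0 := by
          intro c h1 h2 hce
          by_contra hne
          rw [hA, not_not] at h1
          exact (hA _).mp h2
            (hback _ _ h1 ⟨c, hce, Or.inr ⟨rfl, rfl, lt_of_le_of_ne (hf c).1 (Ne.symm hne)⟩⟩)
        have hsum := sum_divergence X A f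
        rw [Finset.sum_eq_zero fun v _ => hdiv v] at hsum
        have h1 : (∑ c, if X.src c ∉ A ∧ X.tgt c ∈ A then f c else 0) = k := by
          rw [Finset.sum_eq_single e]
          · simp [hsA, htA, hfe]
          · intro c _ hce
            split_ifs with h
            · exact hin c h.1 h.2 hce
            · rfl
          · simp
        have h2 := hμ (Finset.univ.filter fun c => X.src c ∈ A ∧ X.tgt c ∉ A)
          (Or.inr ⟨{x | x ∈ A}, htA, hsA, fun c => by simp⟩)
        have h3 : (∑ c, if X.src c ∈ A ∧ X.tgt c ∉ A then f c else 0) =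
            ((∑ c ∈ Finset.univ.filter (fun c => X.src c ∈ A ∧ X.tgt c ∉ A), t c : ℕ) : ℤ) := by
          rw [← Finset.sum_filter, Nat.cast_sum]
          refine Finset.sum_congr rfl fun c hc => ?_
          simp only [Finset.mem_filter, Finset.mem_univ, true_and] at hc
          exact hout c hc.1 hc.2
        omega
  obtain ⟨f, hf, hfe, hdiv⟩ := main μ le_rfl
  have hcast : ∀ c, ((f c).toNat : ℤ) = f c := fun c => Int.toNat_of_nonneg (hf c).1
  refine ⟨fun c => (f c).toNat, fun c => ?_, ?_, fun v => ?_⟩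
  · have := hf c
    change (f c).toNat ≤ t c
    omega
  · simp [hfe]
  · have h := hdiv v
    rw [divergence, Finset.sum_sub_distrib, sub_eq_zero, ← Finset.sum_filter,
      ← Finset.sum_filter, Finset.sum_subtype (p := fun c => X.src c = v) _ (by simp),
      Finset.sum_subtype (p := fun c => X.tgt c = v) _ (by simp)] at h
    apply Int.ofNat_injective
    simp only [Int.ofNat_eq_natCast, Nat.cast_sum, hcast]
    exact h

end IntegerFlows

/-! ### From the natural preorder to a meet semilattice. -/

section NaturalOrder

variable {M : Type*} [AddCommMonoid M]

theorem NatLE.trans {x y z : M} (h : NatLE x y) (h' : NatLE y z) : NatLE x z := by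
  obtain ⟨p, rfl⟩ := h
  obtain ⟨q, rfl⟩ := h'
  exact ⟨p + q, add_assoc _ _ _⟩

theorem NatLE.refl (x : M) : NatLE x x := ⟨0, (add_zero x).symm⟩

theorem NatLE.sum {ι : Type*} (s : Finset ι) {f g : ι → M} (h : ∀ i, NatLE (f i) (g i)) :
    NatLE (∑ i ∈ s, f i) (∑ i ∈ s, g i) := by
  choose z hz using h
  exact ⟨∑ i ∈ s, z i, by rw [← Finset.sum_add_distrib]; exact Finset.sum_congr rfl fun i _ => hz i⟩

/-- Both `x` and `y` are greatest lower bounds of `{x, x}`, and these are unique. -/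
theorem NaturallyInfSemilatticeOrdered.antisymm (h : NaturallyInfSemilatticeOrdered M) {x y : M}
    (hxy : NatLE x y) (hyx : NatLE y x) : x = y := by
  refine (h.1 x x).unique ⟨?_, fun b hb => hb x (by simp)⟩
    ⟨?_, fun b hb => (hb x (by simp)).trans hxy⟩
  · rintro z (rfl | rfl) <;> exact NatLE.refl _
  · rintro z (rfl | rfl) <;> exact hyx

/-- The meet semilattice given by the natural preorder. -/
noncomputable abbrev NaturallyInfSemilatticeOrdered.semilatticeInf
    (h : NaturallyInfSemilatticeOrdered M) : SemilatticeInf M where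
  le := NatLE
  le_refl := NatLE.refl
  le_trans _ _ _ := NatLE.trans
  le_antisymm _ _ := h.antisymm
  inf x y := (h.1 x y).choose
  inf_le_left x y := (h.1 x y).choose_spec.1.1 x (by simp)
  inf_le_right x y := (h.1 x y).choose_spec.1.1 y (by simp)
  le_inf x y z hy hz := (h.1 y z).choose_spec.1.2 x (by
    rintro w (rfl | rfl)
    exacts [hy, hz])

/-- Every finite family admits a refinement in which the meet of finitely many `ℕ`-linear forms is
computed coefficientwise. -/
theorem NaturallyInfSemilatticeOrdered.exists_common_refinement
    (hM : NaturallyInfSemilatticeOrdered M) {E : Type*} [Fintype E] (g : E → M)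
    {F : Finset (E → ℕ)} (hF : F.Nonempty) :
    ∃ (κ : Type) (_ : Fintype κ) (h : κ → M) (t : E → κ → ℕ) (μ : κ → ℕ),
      (∀ c, g c = ∑ k, t c k • h k) ∧ (∀ n ∈ F, ∀ k, μ k ≤ ∑ c, n c * t c k) ∧
      ∀ z : M, (∀ n ∈ F, NatLE z (∑ c, n c • g c)) → NatLE z (∑ k, μ k • h k) := by
  let _ := hM.semilatticeInf
  have : CanonicallyOrderedAdd M :=
    { exists_add_of_le := fun h => h
      le_add_self := fun a b => ⟨b, add_comm b a⟩
      le_self_add := fun a b => ⟨b, rfl⟩ }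
  have : IsOrderedAddMonoid M := CanonicallyOrderedAdd.toIsOrderedAddMonoid
  refine AlgMFMC.exists_common_refinement (fun x y z => ?_) g hF
  have h := hM.2 x y z _ (hM.1 x y).choose_spec.1
  exact (hM.1 (x + z) (y + z)).unique h (hM.1 (x + z) (y + z)).choose_spec.1

end NaturalOrder

/-! ### The two inequalities. -/

section Duality

variable {S : Type*} [CommSemiring S] {M : Type*} [AddCommMonoid M] [Module S M]
  {V E : Type*} [Finite V] [Fintype E] {X : DiGraph V E} {ω : E → M} {e : E}

omit [Module S M] in
/-- The value of a flow at `e` is at most the capacity of any `e`-cut. -/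
theorem IsFlow.natLE_cut (hX : X.AcyclicWithout e) {φ : E → M} (hφ : IsFlow X ω φ) {C : Finset E}
    (hC : X.IsEdgeCut e C) : NatLE (φ e) (∑ c ∈ C, ω c) := by
  classical
  rcases hC with rfl | ⟨A, hs, ht, hC⟩
  · simpa using hφ.1 e
  · let _ := Fintype.ofFinite V
    have h := sum_entering_eq_sum_leaving hX (φ := φ) (fun v => by convert hφ.2 v) _
      (Finset.univ.filter fun v => v ∈ A) rfl (by simpa using ht)
    simp only [Finset.mem_filter, Finset.mem_univ, true_and] at h
    have hout : (∑ c, if X.src c ∈ A ∧ X.tgt c ∉ A then φ c else 0) = ∑ c ∈ C, φ c := by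
      rw [← Finset.sum_filter]
      refine Finset.sum_congr ?_ fun _ _ => rfl
      ext c
      simp [hC c]
    refine NatLE.trans ?_ (NatLE.sum C hφ.1)
    rw [← hout, ← h, ← Finset.add_sum_erase _ _ (Finset.mem_univ e), if_pos ⟨ht, hs⟩]
    exact ⟨_, rfl⟩

/-- Some decomposable flow attains the meet of the capacities of the `e`-cuts. -/
theorem exists_decomposable_flow (S : Type*) [CommSemiring S] [Module S M]
    (hM : NaturallyInfSemilatticeOrdered M) (X : DiGraph V E) (ω : E → M) (e : E) :
    ∃ φ : E → M, IsFlow X ω φ ∧ IsDecomposable S X φ ∧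
      ∀ z : M, (∀ C, X.IsEdgeCut e C → NatLE z (∑ c ∈ C, ω c)) → NatLE z (φ e) := by
  classical
  -- Cut capacities are `ℕ`-linear forms in `ω` with coefficients 0 and 1.
  let ind : Finset E → E → ℕ := fun C c => if c ∈ C then 1 else 0
  have hne : (Finset.univ.filter fun C => X.IsEdgeCut e C).Nonempty :=
    ⟨({e} : Finset E), Finset.mem_filter.mpr ⟨Finset.mem_univ _, Or.inl rfl⟩⟩
  obtain ⟨κ, _, h, t, μ, hω, hμ, hz⟩ := hM.exists_common_refinement ω
    (F := (Finset.univ.filter fun C => X.IsEdgeCut e C).image ind)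
    (hne.image ind)
  have hcut : ∀ (k : κ) (C : Finset E), X.IsEdgeCut e C → μ k ≤ ∑ c ∈ C, t c k := fun k C hC => by
    simpa [ind] using hμ (ind C) (Finset.mem_image_of_mem ind (by simpa using hC)) k
  choose f hft hfe hf using fun k => exists_circulation X e (fun c => t c k) (μ k) (hcut k)
  refine ⟨fun c => ∑ k, f k c • h k, ⟨fun c => ?_, fun v => ?_⟩,
    isDecomposable_sum_smul X f h hf, fun z hz' => ?_⟩
  · rw [hω c]
    refine NatLE.sum _ fun k => ⟨(t c k - f k c) • h k, ?_⟩
    rw [← add_smul, Nat.add_sub_cancel' (hft k c)]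
  · refine Finset.sum_comm.trans (Eq.trans (Finset.sum_congr rfl fun k _ => ?_) Finset.sum_comm)
    rw [← Finset.sum_smul, ← Finset.sum_smul]
    congr 1
    convert hf k v
  · simp only [hfe]
    refine hz z fun n hn => ?_
    obtain ⟨C, hC, rfl⟩ := Finset.mem_image.mp hn
    simpa [ind] using hz' C (by simpa using hC)

end Duality

end AlgMFMC

theorem mainTheorem3 {S : Type*} [CommSemiring S] {M : Type*} [AddCommMonoid M] [Module S M]
    (hcomplete : AlgMFMC.NaturallyComplete M)
    (hinf : AlgMFMC.NaturallyInfSemilatticeOrdered M)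
    {V E : Type*} [Finite V] [Fintype E] (X : AlgMFMC.DiGraph V E) (ω : E → M)
    (e : E) (hacyclic : X.AcyclicWithout e) :
    ∃ m : M,
      AlgMFMC.IsNatLUB (AlgMFMC.flowValues S X ω e) m ∧
      AlgMFMC.IsNatGLB {x : M | ∃ C : Finset E, X.IsEdgeCut e C ∧ ∑ c ∈ C, ω c = x} m ∧
      ((∀ x : M, AlgMFMC.NatLE x (ω e)) →
        AlgMFMC.IsNatGLB {x : M | ∃ C : Finset E, X.IsProperEdgeCut e C ∧ ∑ c ∈ C, ω c = x} m) := by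
  obtain ⟨φ, hφ, hdec, hmax⟩ := AlgMFMC.exists_decomposable_flow S hinf X ω e
  refine ⟨φ e, ⟨?_, fun b hb => hb _ ⟨φ, hφ, hdec, rfl⟩⟩, ⟨?_, fun b hb => ?_⟩,
    fun htop => ⟨?_, fun b hb => ?_⟩⟩
  · rintro x ⟨ψ, hψ, -, rfl⟩
    exact hmax _ fun C hC => hψ.natLE_cut hacyclic hC
  · rintro x ⟨C, hC, rfl⟩
    exact hφ.natLE_cut hacyclic hC
  · exact hmax b fun C hC => hb _ ⟨C, hC, rfl⟩
  · rintro x ⟨C, hC, rfl⟩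
    exact hφ.natLE_cut hacyclic (Or.inr hC)
  · refine hmax b fun C hC => ?_
    -- When `ω e` is greatest, the cut `{e}` imposes no condition on a lower bound.
    rcases hC with rfl | hC
    · simpa using htop b
    · exact hb _ ⟨C, hC, rfl⟩
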